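/- A \emph{pomonoid} is a monoid with a partial order such that $t\le u$ implies $st\le su$ and $ts\le us$. A right $U$-poset over a pomonoid $U$ is a poset $X$ with a right monoid action of $U$ that is monotone in both variables; left $U$-posets are dual. The tensor product $X\otimes_U Y$ of a right $U$-poset $X$ and a left $U$-poset $Y$ is the quotient of the poset $X\times Y$ by the poset congruence generated by the pairs $((xu,y),(x,uy))$. A subpomonoid $U$ of a pomonoid $S$ is \emph{strongly pounitary} in $S$ if for all $u,v\in U$ and $s\in S$, each of $v\le su$, $su\le v$, $v\le us$, $us\le v$ implies $s\in U$. It has the \emph{poextension property} in $S$ if for every right $U$-poset $X$ and every left $U$-poset $Y$ the map $X\otimes_U Y\to X\otimes_U S\otimes_U Y$, $x\otimes y\mapsto x\otimes 1\otimes y$, is an order embedding. A pomonoid amalgam $[U;S_1,S_2]$ consists of pomonoids $U,S_1,S_2$ and monoid homomorphisms $\varphi_i:U\to S_i$ that are order embeddings; $U$ is identified with its images. It is \emph{strongly poembedded} in a pomonoid $W$ by monoid homomorphisms $\theta_i:S_i\to W$ if $\theta_1,\theta_2$ are order embeddings, $\theta_1\varphi_1=\theta_2\varphi_2$ and $\theta_1(S_1)\cap\theta_2(S_2)=\theta_1\varphi_1(U)$;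 it is \emph{strongly poembeddable} if such $W,\theta_1,\theta_2$ exist. The amalgamated free product $S_1\ast_U S_2$ is the pushout of $\varphi_1,\varphi_2$ in the category of pomonoids and monotone monoid homomorphisms. \textbf{Theorem.} Let $[U;S_1,S_2]$ be a pomonoid amalgam such that $U$ is strongly pounitary in both $S_1$ and $S_2$. Then the amalgam is strongly poembeddable; in fact the canonical maps $S_i\to S_1\ast_U S_2$ strongly poembed it in $S_1\ast_U S_2$. Moreover $U$, identified with its image in $S_1\ast_U S_2$, has the poextension property in $S_1\ast_U S_2$ and is strongly pounitary in $S_1\ast_U S_2$. -/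

import Mathlib

open MulOpposite

/-! A pomonoid is a monoid with a partial order for which multiplication is monotone on both sides:
`[Monoid S] [PartialOrder S] [MulLeftMono S] [MulRightMono S]`.
A left `U`-poset is a poset `B` with `[MulAction U B] [IsOrderedSMul U B]`; a right `U`-poset is a
poset `A` with `[MulAction Uᵐᵒᵖ A] [IsOrderedSMul Uᵐᵒᵖ A]`, where `op u • a` is `a u`
(the order on `Uᵐᵒᵖ` is the order of `U`). -/

universe u v w x y

namespace Pomonoid

/-! ### Tensor products of posets over a pomonoid -/

section Tensor

/-- The compatible quasi-order on `A × B` generated by `(a u, b) ∼ (a, u b)`: the least preorder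
that contains the componentwise order and both directions of these pairs. -/
inductive TensorLE (U : Type*) [Monoid U] (A B : Type*) [PartialOrder A] [PartialOrder B]
    [MulAction Uᵐᵒᵖ A] [MulAction U B] : A × B → A × B → Prop
  | of_le {p q : A × B} : p ≤ q → TensorLE U A B p q
  | slide (a : A) (u : U) (b : B) : TensorLE U A B (op u • a, b) (a, u • b)
  | slide' (a : A) (u : U) (b : B) : TensorLE U A B (a, u • b) (op u • a, b)
  | trans {p q r : A × B} : TensorLE U A B p q → TensorLE U A B q r → TensorLE U A B p r

variable (U : Type*) [Monoid U] (A B : Type*) [PartialOrder A] [PartialOrder B]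
  [MulAction Uᵐᵒᵖ A] [MulAction U B]

/-- The set `A × B` with the quasi-order `TensorLE`. -/
def TensorPre (_U : Type*) (A B : Type*) : Type _ := A × B

instance : Preorder (TensorPre U A B) where
  le := TensorLE U A B
  le_refl p := TensorLE.of_le (le_refl (α := A × B) p)
  le_trans _ _ _ := TensorLE.trans

/-- The tensor product `A ⊗_U B` of a right `U`-poset `A` and a left `U`-poset `B`. -/
def Tensor : Type _ := Antisymmetrization (TensorPre U A B) (· ≤ ·)

instance : PartialOrder (Tensor U A B) :=
  inferInstanceAs (PartialOrder (Antisymmetrization (TensorPre U A B) (· ≤ ·)))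

variable {A B}

/-- The element `a ⊗ b` of `A ⊗_U B`. -/
def tmul (a : A) (b : B) : Tensor U A B :=
  toAntisymmetrization (α := TensorPre U A B) (· ≤ ·) (a, b)

variable {U}

theorem tmul_le_tmul_iff {a a' : A} {b b' : B} :
    tmul U a b ≤ tmul U a' b' ↔ TensorLE U A B (a, b) (a', b') := Iff.rfl

theorem tmul_mono {a a' : A} {b b' : B} (ha : a ≤ a') (hb : b ≤ b') :
    tmul U a b ≤ tmul U a' b' := TensorLE.of_le ⟨ha, hb⟩

theorem tmul_slide (a : A) (u : U) (b : B) : tmul U (op u • a) b = tmul U a (u • b) :=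
  le_antisymm (TensorLE.slide a u b) (TensorLE.slide' a u b)

theorem Tensor.ind {motive : Tensor U A B → Prop} (h : ∀ a b, motive (tmul U a b))
    (t : Tensor U A B) : motive t := Quotient.ind (fun p : A × B => h p.1 p.2) t

/-- A monotone balanced map on `A × B` factors through `A ⊗_U B`. -/
def Tensor.lift {C : Type*} [PartialOrder C] (f : A → B → C)
    (hf : ∀ a a' b b', a ≤ a' → b ≤ b' → f a b ≤ f a' b')
    (hs : ∀ a (u : U) b, f (op u • a) b = f a (u • b)) : Tensor U A B →o C :=
  have key : ∀ p q : A × B, TensorLE U A B p q → f p.1 p.2 ≤ f q.1 q.2 := by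
    intro p q h
    induction h with
    | of_le h => exact hf _ _ _ _ h.1 h.2
    | slide a u b => exact (hs a u b).le
    | slide' a u b => exact (hs a u b).ge
    | trans _ _ h₁ h₂ => exact h₁.trans h₂
  { toFun := Quotient.lift (fun p : A × B => f p.1 p.2)
      fun p q h => le_antisymm (key p q h.1) (key q p h.2)
    monotone' := fun s t => Quotient.inductionOn₂ s t fun p q h => key p q h }

@[simp] theorem Tensor.lift_tmul {C : Type*} [PartialOrder C] (f : A → B → C)
    (hf : ∀ a a' b b', a ≤ a' → b ≤ b' → f a b ≤ f a' b')
    (hs : ∀ a (u : U) b, f (op u • a) b = f a (u • b)) (a : A) (b : B) :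
    Tensor.lift f hf hs (tmul U a b) = f a b := rfl

/-! If `B` is a `(U, T)`-poset, then `A ⊗_U B` is a right `T`-poset by `(a ⊗ b) t = a ⊗ (b t)`. -/

variable {T : Type*} [Monoid T] [PartialOrder T] [MulAction Tᵐᵒᵖ B]
  [IsOrderedSMul Tᵐᵒᵖ B] [SMulCommClass U Tᵐᵒᵖ B]

/-- Right multiplication by a fixed element of `T` on `A ⊗_U B`. -/
def Tensor.rightAct (t : Tᵐᵒᵖ) : Tensor U A B →o Tensor U A B :=
  Tensor.lift (fun a b => tmul U a (t • b))
    (fun _ _ _ _ ha hb => tmul_mono ha (IsOrderedSMul.smul_le_smul_left _ _ hb t))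
    (fun a u b => by rw [tmul_slide, smul_comm])

instance : MulAction Tᵐᵒᵖ (Tensor U A B) where
  smul t := Tensor.rightAct t
  one_smul := Tensor.ind fun a b => congrArg (tmul U a) (one_smul _ b)
  mul_smul s t := Tensor.ind fun a b => congrArg (tmul U a) (mul_smul s t b)

theorem smul_tmul (t : Tᵐᵒᵖ) (a : A) (b : B) : t • tmul U a b = tmul U a (t • b) := rfl

instance : IsOrderedSMul Tᵐᵒᵖ (Tensor U A B) where
  smul_le_smul_left _ _ h t := (Tensor.rightAct t).monotone h
  smul_le_smul_right _ _ h :=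
    Tensor.ind fun _ b => tmul_mono le_rfl (IsOrderedSMul.smul_le_smul_right _ _ h b)

end Tensor

/-! ### Subpomonoids: a pomonoid as a biposet over a subpomonoid -/

section Sub

variable {S : Type*} [Monoid S]

/-- A submonoid `V` of `S` acts on `S` from the right by `s v = s * v`. (The left action is the
usual one.) -/
instance (V : Submonoid S) : MulAction (↥V)ᵐᵒᵖ S where
  smul v s := s * ((unop v : ↥V) : S)
  one_smul s := mul_one s
  mul_smul v w s := (mul_assoc s ((unop w : ↥V) : S) ((unop v : ↥V) : S)).symm

theorem op_smul_def (V : Submonoid S) (v : (↥V)ᵐᵒᵖ) (s : S) : v • s = s * ((unop v : ↥V) : S) := rfl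

instance (V : Submonoid S) : SMulCommClass ↥V (↥V)ᵐᵒᵖ S where
  smul_comm v w s := (mul_assoc (v : S) s ((unop w : ↥V) : S)).symm

variable [PartialOrder S] [MulLeftMono S] [MulRightMono S]

instance (V : Submonoid S) : IsOrderedSMul ↥V S where
  smul_le_smul_left _ _ h v := mul_le_mul_right h (v : S)
  smul_le_smul_right _ _ h s := mul_le_mul_left (Subtype.coe_le_coe.2 h) s

instance (V : Submonoid S) : IsOrderedSMul (↥V)ᵐᵒᵖ S where
  smul_le_smul_left _ _ h v := mul_le_mul_left h ((unop v : ↥V) : S)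
  smul_le_smul_right v w h s := mul_le_mul_right (show ((unop v : ↥V) : S) ≤ ((unop w : ↥V) : S) from h) s

/-- The map `X ⊗_V Y → X ⊗_V S ⊗_V Y`, `x ⊗ y ↦ x ⊗ 1 ⊗ y`. -/
def insertOne (V : Submonoid S) (X Y : Type*)
    [PartialOrder X] [MulAction (↥V)ᵐᵒᵖ X] [IsOrderedSMul (↥V)ᵐᵒᵖ X]
    [PartialOrder Y] [MulAction ↥V Y] [IsOrderedSMul ↥V Y] :
    Tensor V X Y →o Tensor V (Tensor V X S) Y :=
  Tensor.lift (fun x y => tmul V (tmul V x (1 : S)) y)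
    (fun _ _ _ _ hx hy => tmul_mono (tmul_mono hx le_rfl) hy)
    (fun x v y => by
      rw [tmul_slide, ← tmul_slide (tmul V x (1 : S)) v y, smul_tmul]
      congr 2
      exact (mul_one (v : S)).trans (one_mul (v : S)).symm)

/-- `V` has the poextension property in `S`: for all right `V`-posets `X` and left `V`-posets `Y`,
the map `X ⊗_V Y → X ⊗_V S ⊗_V Y` is an order embedding. -/
def HasPoextension (V : Submonoid S) : Prop :=
  ∀ (X : Type x) [PartialOrder X] [MulAction (↥V)ᵐᵒᵖ X] [IsOrderedSMul (↥V)ᵐᵒᵖ X]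
    (Y : Type y) [PartialOrder Y] [MulAction ↥V Y] [IsOrderedSMul ↥V Y]
    (p q : Tensor V X Y), insertOne V X Y p ≤ insertOne V X Y q ↔ p ≤ q

end Sub

/-! ### Strongly pounitary subpomonoids -/

section Pounitary

variable {S : Type*} [Monoid S] [PartialOrder S]

/-- `V` is strongly right pounitary in `S`. -/
def StronglyRightPounitary (V : Submonoid S) : Prop :=
  ∀ u ∈ V, ∀ v ∈ V, ∀ s : S, v ≤ s * u ∨ s * u ≤ v → s ∈ V

/-- `V` is strongly left pounitary in `S`. -/
def StronglyLeftPounitary (V : Submonoid S) : Prop :=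
  ∀ u ∈ V, ∀ v ∈ V, ∀ s : S, v ≤ u * s ∨ u * s ≤ v → s ∈ V

/-- `V` is strongly pounitary in `S`: strongly right and strongly left pounitary. -/
def StronglyPounitary (V : Submonoid S) : Prop :=
  StronglyRightPounitary V ∧ StronglyLeftPounitary V

end Pounitary

/-! ### Pomonoid amalgams -/

/-- A pomonoid morphism that is an order embedding. -/
def IsPoembedding {S T : Type*} [Monoid S] [PartialOrder S] [Monoid T] [PartialOrder T]
    (f : S →* T) : Prop := ∀ s t : S, f s ≤ f t ↔ s ≤ t

section Amalgam

variable {U S₁ S₂ : Type*} [Monoid U]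
  [Monoid S₁] [PartialOrder S₁] [Monoid S₂] [PartialOrder S₂]

/-- The maps `θ₁ : S₁ → W`, `θ₂ : S₂ → W` strongly poembed the amalgam `[U; S₁, S₂; φ₁, φ₂]`
in `W`. -/
structure IsStrongPoembedding (φ₁ : U →* S₁) (φ₂ : U →* S₂) {W : Type*} [Monoid W]
    [PartialOrder W] (θ₁ : S₁ →* W) (θ₂ : S₂ →* W) : Prop where
  poembedding₁ : IsPoembedding θ₁
  poembedding₂ : IsPoembedding θ₂
  comp_eq : θ₁.comp φ₁ = θ₂.comp φ₂
  inter_eq : Set.range θ₁ ∩ Set.range θ₂ = Set.range (θ₁.comp φ₁)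

/-- The amalgam `[U; S₁, S₂; φ₁, φ₂]` is strongly poembeddable in some pomonoid (in the universe
`w`). -/
def StronglyPoembeddable (φ₁ : U →* S₁) (φ₂ : U →* S₂) : Prop :=
  ∃ (W : Type w) (_ : Monoid W) (_ : PartialOrder W) (_ : MulLeftMono W) (_ : MulRightMono W)
    (θ₁ : S₁ →* W) (θ₂ : S₂ →* W), IsStrongPoembedding φ₁ φ₂ θ₁ θ₂

/-- The least quasi-order on the free product of the monoids `S₁` and `S₂` that is compatible with
multiplication, extends the orders of `S₁` and `S₂`, and identifies `φ₁ u` with `φ₂ u`. -/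
inductive AmalgLE (φ₁ : U →* S₁) (φ₂ : U →* S₂) :
    Monoid.Coprod S₁ S₂ → Monoid.Coprod S₁ S₂ → Prop
  | refl (x) : AmalgLE φ₁ φ₂ x x
  | trans {x y z} : AmalgLE φ₁ φ₂ x y → AmalgLE φ₁ φ₂ y z → AmalgLE φ₁ φ₂ x z
  | mul {x y x' y'} : AmalgLE φ₁ φ₂ x x' → AmalgLE φ₁ φ₂ y y' → AmalgLE φ₁ φ₂ (x * y) (x' * y')
  | inl {s t : S₁} : s ≤ t → AmalgLE φ₁ φ₂ (Monoid.Coprod.inl s) (Monoid.Coprod.inl t)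
  | inr {s t : S₂} : s ≤ t → AmalgLE φ₁ φ₂ (Monoid.Coprod.inr s) (Monoid.Coprod.inr t)
  | glue (u : U) : AmalgLE φ₁ φ₂ (Monoid.Coprod.inl (φ₁ u)) (Monoid.Coprod.inr (φ₂ u))
  | glue' (u : U) : AmalgLE φ₁ φ₂ (Monoid.Coprod.inr (φ₂ u)) (Monoid.Coprod.inl (φ₁ u))

variable (φ₁ : U →* S₁) (φ₂ : U →* S₂)

/-- The congruence on the free product belonging to `AmalgLE`. -/
def amalgCon : Con (Monoid.Coprod S₁ S₂) where
  r x y := AmalgLE φ₁ φ₂ x y ∧ AmalgLE φ₁ φ₂ y x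
  iseqv := ⟨fun x => ⟨.refl x, .refl x⟩, fun h => ⟨h.2, h.1⟩,
    fun h k => ⟨h.1.trans k.1, k.2.trans h.2⟩⟩
  mul' h k := ⟨h.1.mul k.1, h.2.mul k.2⟩

/-- The amalgamated free product `S₁ *_U S₂` in the category of pomonoids. -/
def AmalgProd : Type _ := (amalgCon φ₁ φ₂).Quotient

instance : Monoid (AmalgProd φ₁ φ₂) := inferInstanceAs (Monoid (amalgCon φ₁ φ₂).Quotient)

namespace AmalgProd

/-- The quotient map from the free product of monoids. -/
def mk : Monoid.Coprod S₁ S₂ →* AmalgProd φ₁ φ₂ := (amalgCon φ₁ φ₂).mk'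

variable {φ₁ φ₂} in
theorem ind {motive : AmalgProd φ₁ φ₂ → Prop} (h : ∀ x, motive (mk φ₁ φ₂ x))
    (p : AmalgProd φ₁ φ₂) : motive p := Quotient.ind h p

instance : PartialOrder (AmalgProd φ₁ φ₂) where
  le p q := Quotient.liftOn₂ p q (AmalgLE φ₁ φ₂) fun _ _ _ _ h k =>
    propext ⟨fun l => (h.2.trans l).trans k.1, fun l => (h.1.trans l).trans k.2⟩
  le_refl := ind fun x => AmalgLE.refl x
  le_trans p q r := Quotient.inductionOn₃ p q r fun _ _ _ => AmalgLE.trans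
  le_antisymm p q := Quotient.inductionOn₂ p q fun _ _ h k => Quotient.sound ⟨h, k⟩

theorem mk_le_mk_iff {x y : Monoid.Coprod S₁ S₂} :
    mk φ₁ φ₂ x ≤ mk φ₁ φ₂ y ↔ AmalgLE φ₁ φ₂ x y := Iff.rfl

instance : MulLeftMono (AmalgProd φ₁ φ₂) where
  elim p q r := Quotient.inductionOn₃ p q r fun x _ _ h => (AmalgLE.refl x).mul h

instance : MulRightMono (AmalgProd φ₁ φ₂) where
  elim p q r := Quotient.inductionOn₃ p q r fun x _ _ h => AmalgLE.mul h (AmalgLE.refl x)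

/-- The canonical map `S₁ → S₁ *_U S₂`. -/
def inl : S₁ →* AmalgProd φ₁ φ₂ := (mk φ₁ φ₂).comp Monoid.Coprod.inl

/-- The canonical map `S₂ → S₁ *_U S₂`. -/
def inr : S₂ →* AmalgProd φ₁ φ₂ := (mk φ₁ φ₂).comp Monoid.Coprod.inr

/-- The canonical map `U → S₁ *_U S₂`. -/
def base : U →* AmalgProd φ₁ φ₂ := (inl φ₁ φ₂).comp φ₁

theorem inl_mono : Monotone (inl φ₁ φ₂) := fun _ _ h => AmalgLE.inl h

theorem inr_mono : Monotone (inr φ₁ φ₂) := fun _ _ h => AmalgLE.inr h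

theorem inl_comp_eq : (inl φ₁ φ₂).comp φ₁ = (inr φ₁ φ₂).comp φ₂ :=
  MonoidHom.ext fun u => le_antisymm
    ((mk_le_mk_iff φ₁ φ₂).2 (.glue u)) ((mk_le_mk_iff φ₁ φ₂).2 (.glue' u))

/-- `S₁ *_U S₂` with its canonical maps is the pushout in the category of pomonoids. -/
theorem existsUnique_lift {W : Type*} [Monoid W] [PartialOrder W] [MulLeftMono W] [MulRightMono W]
    (θ₁ : S₁ →* W) (θ₂ : S₂ →* W) (h₁ : Monotone θ₁) (h₂ : Monotone θ₂)
    (h : θ₁.comp φ₁ = θ₂.comp φ₂) :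
    ∃! ψ : AmalgProd φ₁ φ₂ →* W,
      Monotone ψ ∧ ψ.comp (inl φ₁ φ₂) = θ₁ ∧ ψ.comp (inr φ₁ φ₂) = θ₂ := by
  have key : ∀ x y, AmalgLE φ₁ φ₂ x y →
      Monoid.Coprod.lift θ₁ θ₂ x ≤ Monoid.Coprod.lift θ₁ θ₂ y := by
    intro x y hxy
    induction hxy with
    | refl x => exact le_rfl
    | trans _ _ h k => exact h.trans k
    | mul _ _ h k => rw [map_mul, map_mul]; exact mul_le_mul' h k
    | inl h => exact h₁ h
    | inr h => exact h₂ h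
    | glue u => exact (DFunLike.congr_fun h u).le
    | glue' u => exact (DFunLike.congr_fun h u).ge
  refine ⟨(amalgCon φ₁ φ₂).lift (Monoid.Coprod.lift θ₁ θ₂)
    (fun x y hxy => le_antisymm (key x y hxy.1) (key y x hxy.2)), ⟨?_, ?_, ?_⟩, ?_⟩
  · exact fun p q => Quotient.inductionOn₂ p q fun x y hxy => key x y hxy
  · rfl
  · rfl
  · rintro ψ ⟨-, e₁, e₂⟩
    refine MonoidHom.ext (ind fun x => ?_)
    exact DFunLike.congr_fun (Monoid.Coprod.lift_unique (fg := ψ.comp (mk φ₁ φ₂)) e₁ e₂) x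

end AmalgProd

end Amalgam

end Pomonoid

/-!
A submonoid `V` of `S` that is strongly pounitary absorbs everything comparable with one of its
elements, and `s v ∈ V` or `v s ∈ V` with `v ∈ V` forces `s ∈ V`. Hence `S` is, as a poset with a
left and a right action of `V`, the disjoint incomparable union of `V` and its complement. This
already gives the poextension property (`StronglyPounitary.hasPoextension`): tensoring respects
such unions, so the map that sends `x ⊗ s ⊗ y` to `x s ⊗ y` for `s ∈ V`, and to an additional
incomparable point otherwise, undoes `x ⊗ y ↦ x ⊗ 1 ⊗ y`.

For the amalgam write `S i = U ⊔ T i`. The amalgamated free product should be the disjoint union of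
the tensor products `T i₁ ⊗ ⋯ ⊗ T iₙ ⊗ U` over `U`, for all alternating sequences of indices.
Elements of these tensor products are represented by words (`Word`), with the quasi-order `Word.Rel`
generated by the componentwise order and by sliding elements of `U` between neighbouring letters.
The words that alternate and have no letter in `U` are the reduced ones; their quotient
`NormalForm φ` is a poset on which each `S i` acts (`NormalForm.act`). The action exists because
`NormalForm φ` is `S i ⊗ Fᵢ`, where `Fᵢ` is the part whose words do not begin with `i`. By
the universal property the amalgamated free product `W` acts on normal forms as well.

Two invariants of the quasi-order carry the proof. One is the sequence of indices of the letters
(`Word.letters`), which shows that the parts of the disjoint union are incomparable. The other is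
the evaluation of a word as a product (`Word.eval`), in `W` or, for words all of whose letters have
index `i`, in `S i`. Applying `p : W` to the empty word `1` and evaluating recovers `p`. Thus
`p` lies in `U` as soon as `p • 1` has no letters, and `S i` embeds in `W` because the one-letter
words over `i` embed in `S i`.
-/

namespace Pomonoid

/-! ### The poextension property of a strongly pounitary submonoid -/

section Poextension

variable {S : Type*} [Monoid S] [PartialOrder S]

theorem StronglyPounitary.mem_iff_of_le {V : Submonoid S} (h : StronglyPounitary V) {s t : S}
    (hst : s ≤ t) : s ∈ V ↔ t ∈ V :=
  ⟨fun hs => h.1 1 V.one_mem s hs t (Or.inl (by simpa using hst)),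
    fun ht => h.1 1 V.one_mem t ht s (Or.inr (by simpa using hst))⟩

theorem StronglyPounitary.mul_mem_iff_left {V : Submonoid S} (h : StronglyPounitary V) {s v : S}
    (hv : v ∈ V) : s * v ∈ V ↔ s ∈ V :=
  ⟨fun hs => h.1 v hv _ hs s (Or.inl le_rfl), fun hs => V.mul_mem hs hv⟩

theorem StronglyPounitary.mul_mem_iff_right {V : Submonoid S} (h : StronglyPounitary V) {s v : S}
    (hv : v ∈ V) : v * s ∈ V ↔ s ∈ V :=
  ⟨fun hs => h.2 v hv _ hs s (Or.inl le_rfl), fun hs => V.mul_mem hv hs⟩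

section Retraction

variable (V : Submonoid S) {X Y : Type*}
  [PartialOrder X] [MulAction (↥V)ᵐᵒᵖ X] [PartialOrder Y] [MulAction ↥V Y]

open Classical in
/-- The triple `(x, s, y)` is sent to `x s ⊗ y` if `s ∈ V`, and to an additional point, comparable
only with itself, otherwise. -/
noncomputable def tripleToTensor (x : X) (s : S) (y : Y) : Tensor V X Y ⊕ PUnit.{1} :=
  if h : s ∈ V then Sum.inl (tmul V (op (⟨s, h⟩ : V) • x) y) else Sum.inr PUnit.unit

variable {V}

theorem tripleToTensor_slide_left (hV : StronglyPounitary V) (x : X) (v : V) (s : S) (y : Y) :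
    tripleToTensor V (op v • x) s y = tripleToTensor V x (v • s) y := by
  have hmem : v • s ∈ V ↔ s ∈ V := hV.mul_mem_iff_right v.2
  by_cases h : s ∈ V
  · have h' := hmem.2 h
    simp only [tripleToTensor, h, h', dif_pos, smul_smul]
    rfl
  · have h' : v • s ∉ V := fun k => h (hmem.1 k)
    simp only [tripleToTensor, h, h', dif_neg, not_false_eq_true]

theorem tripleToTensor_slide_right (hV : StronglyPounitary V) (x : X) (v : V) (s : S) (y : Y) :
    tripleToTensor V x (op v • s) y = tripleToTensor V x s (v • y) := by
  have hmem : op v • s ∈ V ↔ s ∈ V := hV.mul_mem_iff_left v.2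
  by_cases h : s ∈ V
  · have h' := hmem.2 h
    simp only [tripleToTensor, h, h', dif_pos, ← tmul_slide, smul_smul]
    rfl
  · have h' : op v • s ∉ V := fun k => h (hmem.1 k)
    simp only [tripleToTensor, h, h', dif_neg, not_false_eq_true]

variable [IsOrderedSMul (↥V)ᵐᵒᵖ X]

theorem tripleToTensor_mono (hV : StronglyPounitary V) {x x' : X} {s s' : S} {y y' : Y}
    (hx : x ≤ x') (hs : s ≤ s') (hy : y ≤ y') :
    tripleToTensor V x s y ≤ tripleToTensor V x' s' y' := by
  have hmem := hV.mem_iff_of_le hs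
  by_cases h : s ∈ V
  · have h' := hmem.1 h
    simp only [tripleToTensor, h, h', dif_pos]
    refine Sum.inl_le_inl_iff.2 (tmul_mono ?_ hy)
    exact (IsOrderedSMul.smul_le_smul_left _ _ hx _).trans
      (IsOrderedSMul.smul_le_smul_right (op (⟨s, h⟩ : V)) (op (⟨s', h'⟩ : V)) hs _)
  · have h' : s' ∉ V := fun k => h (hmem.2 k)
    simp only [tripleToTensor, h, h', dif_neg, not_false_eq_true, le_refl]

variable [IsOrderedSMul ↥V Y] [MulLeftMono S] [MulRightMono S]

/-- The retraction of `X ⊗ Y → X ⊗ S ⊗ Y`, with the part `X ⊗ (S \ V) ⊗ Y` collapsed to a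
point. -/
noncomputable def tensorRetraction (hV : StronglyPounitary V) :
    Tensor V (Tensor V X S) Y →o Tensor V X Y ⊕ PUnit.{1} :=
  Tensor.lift
    (fun p y => Tensor.lift (fun x s => tripleToTensor V x s y)
      (fun _ _ _ _ hx hs => tripleToTensor_mono hV hx hs le_rfl)
      (fun x v s => tripleToTensor_slide_left hV x v s y) p)
    (fun p p' y y' hp hy => by
      refine (OrderHom.monotone _ hp).trans ?_
      induction p' using Tensor.ind with
      | h x s => exact tripleToTensor_mono hV le_rfl le_rfl hy)
    (fun p v y => by
      induction p using Tensor.ind with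
      | h x s => exact tripleToTensor_slide_right hV x v s y)

theorem tensorRetraction_insertOne (hV : StronglyPounitary V) (p : Tensor V X Y) :
    tensorRetraction hV (insertOne (S := S) V X Y p) = Sum.inl p := by
  induction p using Tensor.ind with
  | h x y =>
    change tripleToTensor V x (1 : S) y = _
    rw [tripleToTensor, dif_pos V.one_mem]
    congr 2
    exact one_smul _ x

end Retraction

theorem StronglyPounitary.hasPoextension [MulLeftMono S] [MulRightMono S] {V : Submonoid S}
    (hV : StronglyPounitary V) :
    HasPoextension.{x, y} V := by
  intro X _ _ _ Y _ _ _ p q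
  refine ⟨fun h => ?_, fun h => (insertOne V X Y).monotone h⟩
  have := (tensorRetraction hV).monotone h
  rwa [tensorRetraction_insertOne, tensorRetraction_insertOne, Sum.inl_le_inl_iff] at this

end Poextension

/-! ### Words over an amalgam -/

/-- Words `(s₁, …, sₙ, u)` with letters `sₖ ∈ S iₖ` and a last entry `u ∈ U`. They represent the
elements of the tensor products `S i₁ ⊗ ⋯ ⊗ S iₙ ⊗ U` over `U`. -/
inductive Word (U : Type*) {ι : Type*} (S : ι → Type*)
  | nil (u : U) : Word U S
  | cons (i : ι) (s : S i) (r : Word U S) : Word U S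

namespace Word

variable {U ι : Type*} {S : ι → Type*}

/-- The sequence of indices of the letters of a word. -/
def letters : Word U S → List ι
  | nil _ => []
  | cons i _ r => i :: letters r

/-- A word either begins with `i` or not; these cases govern the action of `S i`. -/
theorem head_cases (i : ι) (r : Word U S) :
    r.letters.head? ≠ some i ∨ ∃ s r', r = cons i s r' := by
  cases r with
  | nil u => simp [letters]
  | cons j s r =>
    by_cases h : j = i
    · subst h
      exact Or.inr ⟨s, r, rfl⟩
    · simp [letters, h]

open Classical in
/-- Splits off the first letter if it has index `i`; otherwise the split letter is `1 : S i`. -/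
noncomputable def peel [∀ i, One (S i)] (i : ι) : Word U S → S i × Word U S
  | nil u => (1, nil u)
  | cons j s r => if h : j = i then (h ▸ s, r) else (1, cons j s r)

theorem peel_cons_self [∀ i, One (S i)] (i : ι) (s : S i) (r : Word U S) :
    peel i (cons i s r) = (s, r) := by
  simp [peel]

theorem peel_of_head [∀ i, One (S i)] {i : ι} {r : Word U S} (h : r.letters.head? ≠ some i) :
    peel i r = (1, r) := by
  cases r with
  | nil u => rfl
  | cons j s r =>
    have : j ≠ i := by simpa [letters] using h
    simp [peel, this]

/-- Right multiplication of a word by an element of `U`. -/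
def rightMul [Mul U] (v : U) : Word U S → Word U S
  | nil u => nil (u * v)
  | cons i s r => cons i s (rightMul v r)

@[simp] theorem letters_rightMul [Mul U] (v : U) (r : Word U S) :
    (rightMul v r).letters = r.letters := by
  induction r with
  | nil u => rfl
  | cons i s r ih => simp [rightMul, letters, ih]

variable [Monoid U] [∀ i, Monoid (S i)] (φ : ∀ i, U →* S i)

/-- Left multiplication of a word by an element of `U`. -/
def baseMul (v : U) : Word U S → Word U S
  | nil u => nil (v * u)
  | cons i s r => cons i (φ i v * s) r

@[simp] theorem letters_baseMul (v : U) (r : Word U S) : (baseMul φ v r).letters = r.letters := by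
  cases r <;> rfl

theorem baseMul_one (r : Word U S) : baseMul φ 1 r = r := by
  cases r <;> simp [baseMul]

theorem baseMul_mul (v v' : U) (r : Word U S) :
    baseMul φ (v * v') r = baseMul φ v (baseMul φ v' r) := by
  cases r <;> simp [baseMul, mul_assoc]

theorem rightMul_baseMul (v v' : U) (r : Word U S) :
    rightMul v (baseMul φ v' r) = baseMul φ v' (rightMul v r) := by
  cases r <;> simp [baseMul, rightMul, mul_assoc]

/-- A word is reduced if no letter lies in `U` and the indices of neighbouring letters differ. -/
def Reduced : Word U S → Prop
  | nil _ => True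
  | cons i s r => s ∉ MonoidHom.mrange (φ i) ∧ r.letters.head? ≠ some i ∧ Reduced r

theorem reduced_nil (u : U) : Reduced (S := S) φ (nil u) := trivial

variable {φ} in
theorem Reduced.rightMul {r : Word U S} (h : Reduced φ r) (v : U) :
    Reduced φ (rightMul v r) := by
  induction r with
  | nil u => trivial
  | cons i s r ih => exact ⟨h.1, by simpa using h.2.1, ih h.2.2⟩

open Classical in
/-- The word `s r`, where `s : S i` and `r` does not begin with `i`: elements `s ∈ U` are multiplied
into `r`, other elements form a new letter. -/
noncomputable def mulHead (i : ι) (s : S i) (r : Word U S) : Word U S :=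
  if h : ∃ v, φ i v = s then baseMul φ h.choose r else cons i s r

theorem mulHead_of_notMem {i : ι} {s : S i} (h : s ∉ MonoidHom.mrange (φ i)) (r : Word U S) :
    mulHead φ i s r = cons i s r := dif_neg h

theorem mulHead_map {i : ι} (hi : Function.Injective (φ i)) (v : U) (r : Word U S) :
    mulHead φ i (φ i v) r = baseMul φ v r := by
  have h : ∃ v', φ i v' = φ i v := ⟨v, rfl⟩
  rw [mulHead, dif_pos h, hi h.choose_spec]

/-- Left multiplication of a word by `s : S i`, the result being reduced for a reduced word. -/
noncomputable def act (i : ι) (s : S i) (r : Word U S) : Word U S :=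
  mulHead φ i (s * (peel i r).1) (peel i r).2

theorem act_cons_self (i : ι) (s t : S i) (r : Word U S) :
    act φ i s (cons i t r) = mulHead φ i (s * t) r := by
  rw [act, peel_cons_self]

theorem act_of_head {i : ι} (s : S i) {r : Word U S} (h : r.letters.head? ≠ some i) :
    act φ i s r = mulHead φ i s r := by
  rw [act, peel_of_head h, mul_one]

theorem rightMul_mulHead (v : U) (i : ι) (s : S i) (r : Word U S) :
    rightMul v (mulHead φ i s r) = mulHead φ i s (rightMul v r) := by
  unfold mulHead
  split_ifs
  · exact rightMul_baseMul φ _ _ _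
  · rfl

theorem rightMul_act (v : U) (i : ι) (s : S i) (r : Word U S) :
    rightMul v (act φ i s r) = act φ i s (rightMul v r) := by
  obtain h | ⟨t, r, rfl⟩ := head_cases i r
  · rw [act_of_head φ s h, act_of_head φ s (by simpa using h), rightMul_mulHead]
  · simp only [rightMul, act_cons_self, rightMul_mulHead]

/-! ### The quasi-order on words -/

section Order

variable [PartialOrder U] [∀ i, PartialOrder (S i)]

/-- The quasi-order on words generated by the componentwise order and the slides
`(…, s u, s', …) ∼ (…, s, u s', …)` for `u ∈ U`. -/
inductive Rel : Word U S → Word U S → Prop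
  | nil {u u' : U} : u ≤ u' → Rel (nil u) (nil u')
  | cons {i : ι} {s s' : S i} {r r' : Word U S} :
      s ≤ s' → Rel r r' → Rel (cons i s r) (cons i s' r')
  | slide (i : ι) (s : S i) (v : U) (r : Word U S) :
      Rel (cons i (s * φ i v) r) (cons i s (baseMul φ v r))
  | slide' (i : ι) (s : S i) (v : U) (r : Word U S) :
      Rel (cons i s (baseMul φ v r)) (cons i (s * φ i v) r)
  | trans {r r' r'' : Word U S} : Rel r r' → Rel r' r'' → Rel r r''

variable {φ}

@[refl] theorem Rel.refl (r : Word U S) : Rel φ r r := by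
  induction r with
  | nil u => exact .nil le_rfl
  | cons i s r ih => exact .cons le_rfl ih

theorem Rel.letters_eq {r r' : Word U S} (h : Rel φ r r') : r.letters = r'.letters := by
  induction h with
  | nil _ => rfl
  | cons _ _ ih => simp [letters, ih]
  | slide i s v r => simp [letters]
  | slide' i s v r => simp [letters]
  | trans _ _ h k => exact h.trans k

theorem Rel.rightMul [MulRightMono U] {r r' : Word U S} (h : Rel φ r r') (v : U) :
    Rel φ (rightMul v r) (rightMul v r') := by
  induction h with
  | nil h => exact .nil (mul_le_mul_left h v)
  | cons h _ ih => exact .cons h ih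
  | slide i s v' r => simpa only [Word.rightMul, rightMul_baseMul] using .slide i s v' _
  | slide' i s v' r => simpa only [Word.rightMul, rightMul_baseMul] using .slide' i s v' _
  | trans _ _ h k => exact h.trans k

theorem Rel.baseMul [MulLeftMono U] [∀ i, MulLeftMono (S i)] {r r' : Word U S}
    (h : Rel φ r r') (v : U) : Rel φ (baseMul φ v r) (baseMul φ v r') := by
  induction h with
  | nil h => exact .nil (mul_le_mul_right h v)
  | cons h h' _ => exact .cons (mul_le_mul_right h _) h'
  | slide i s v' r => simpa only [Word.baseMul, ← mul_assoc] using .slide i (φ i v * s) v' r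
  | slide' i s v' r => simpa only [Word.baseMul, ← mul_assoc] using .slide' i (φ i v * s) v' r
  | trans _ _ h k => exact h.trans k

theorem baseMul_rel_of_le [MulRightMono U] [∀ i, MulRightMono (S i)]
    (hφ : ∀ i, IsPoembedding (φ i)) {v v' : U} (h : v ≤ v') (r : Word U S) :
    Rel φ (Word.baseMul φ v r) (Word.baseMul φ v' r) := by
  cases r with
  | nil u => exact .nil (mul_le_mul_left h u)
  | cons i s r => exact .cons (mul_le_mul_left ((hφ i v v').2 h) s) (.refl r)

end Order

/-! ### The action on reduced words -/

theorem _root_.Pomonoid.IsPoembedding.injective {S T : Type*} [Monoid S] [PartialOrder S]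
    [Monoid T] [PartialOrder T] {f : S →* T} (hf : IsPoembedding f) : Function.Injective f :=
  fun s t h => le_antisymm ((hf s t).1 h.le) ((hf t s).1 h.ge)

section Action

variable [PartialOrder U] [∀ i, PartialOrder (S i)] {φ}
  (hφ : ∀ i, IsPoembedding (φ i)) (hU : ∀ i, StronglyPounitary (MonoidHom.mrange (φ i)))

include hφ hU

theorem mulHead_mono [MulLeftMono U] [MulRightMono U] [∀ i, MulLeftMono (S i)]
    [∀ i, MulRightMono (S i)] {i : ι} {s s' : S i} {r r' : Word U S} (hs : s ≤ s')
    (hr : Rel φ r r') :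
    Rel φ (mulHead φ i s r) (mulHead φ i s' r') := by
  by_cases h : s ∈ MonoidHom.mrange (φ i)
  · obtain ⟨v', rfl⟩ := ((hU i).mem_iff_of_le hs).1 h
    obtain ⟨v, rfl⟩ := h
    rw [mulHead_map φ (hφ i).injective, mulHead_map φ (hφ i).injective]
    exact (hr.baseMul v).trans (baseMul_rel_of_le hφ ((hφ i v v').1 hs) r')
  · rw [mulHead_of_notMem φ h, mulHead_of_notMem φ (fun k => h (((hU i).mem_iff_of_le hs).2 k))]
    exact .cons hs hr

theorem mulHead_slide {i : ι} (s : S i) (v : U) (r : Word U S) :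
    Rel φ (mulHead φ i (s * φ i v) r) (mulHead φ i s (baseMul φ v r)) ∧
      Rel φ (mulHead φ i s (baseMul φ v r)) (mulHead φ i (s * φ i v) r) := by
  by_cases h : s ∈ MonoidHom.mrange (φ i)
  · obtain ⟨v', rfl⟩ := h
    rw [← map_mul, mulHead_map φ (hφ i).injective, mulHead_map φ (hφ i).injective, baseMul_mul]
    exact ⟨.refl _, .refl _⟩
  · rw [mulHead_of_notMem φ h,
      mulHead_of_notMem φ (fun k => h (((hU i).mul_mem_iff_left ⟨v, rfl⟩).1 k))]
    exact ⟨.slide i s v r, .slide' i s v r⟩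

theorem act_mono [MulLeftMono U] [MulRightMono U] [∀ i, MulLeftMono (S i)]
    [∀ i, MulRightMono (S i)] (i : ι) {s s' : S i} (hs : s ≤ s') {r r' : Word U S}
    (hr : Rel φ r r') :
    Rel φ (act φ i s r) (act φ i s' r') := by
  have hmono : Rel φ (act φ i s r') (act φ i s' r') :=
    mulHead_mono hφ hU (mul_le_mul' hs le_rfl) (.refl _)
  refine Rel.trans ?_ hmono
  clear hmono hs s'
  -- Generators whose first letter has another index are not touched by the action.
  have aside : ∀ {r r' : Word U S}, Rel φ r r' → r.letters.head? ≠ some i →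
      Rel φ (act φ i s r) (act φ i s r') := by
    intro r r' h hr
    rw [act_of_head φ s hr, act_of_head φ s (h.letters_eq ▸ hr)]
    exact mulHead_mono hφ hU le_rfl h
  induction hr with
  | nil h => exact aside (.nil h) (by simp [letters])
  | @cons j t t' r r' ht hr _ =>
    by_cases hj : j = i
    · subst hj
      rw [act_cons_self, act_cons_self]
      exact mulHead_mono hφ hU (mul_le_mul' le_rfl ht) hr
    · exact aside (.cons ht hr) (by simpa [letters] using hj)
  | slide j t v r =>
    by_cases hj : j = i
    · subst hj
      rw [act_cons_self, act_cons_self, ← mul_assoc]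
      exact (mulHead_slide hφ hU _ v r).1
    · exact aside (.slide j t v r) (by simpa [letters] using hj)
  | slide' j t v r =>
    by_cases hj : j = i
    · subst hj
      rw [act_cons_self, act_cons_self, ← mul_assoc]
      exact (mulHead_slide hφ hU _ v r).2
    · exact aside (.slide' j t v r) (by simpa [letters] using hj)
  | trans _ _ h k => exact h.trans k

theorem act_mulHead {i : ι} (s t : S i) {r : Word U S} (hr : r.letters.head? ≠ some i) :
    Rel φ (act φ i s (mulHead φ i t r)) (mulHead φ i (s * t) r) ∧
      Rel φ (mulHead φ i (s * t) r) (act φ i s (mulHead φ i t r)) := by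
  by_cases h : t ∈ MonoidHom.mrange (φ i)
  · obtain ⟨v, rfl⟩ := h
    rw [mulHead_map φ (hφ i).injective, act_of_head φ s (by simpa using hr)]
    exact (mulHead_slide hφ hU s v r).symm
  · rw [mulHead_of_notMem φ h, act_cons_self]
    exact ⟨.refl _, .refl _⟩

/-- `S i` acts on reduced words up to the equivalence belonging to `Rel`. -/
theorem act_act {i : ι} (s t : S i) {r : Word U S} (hr : Reduced φ r) :
    Rel φ (act φ i s (act φ i t r)) (act φ i (s * t) r) ∧
      Rel φ (act φ i (s * t) r) (act φ i s (act φ i t r)) := by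
  obtain h | ⟨t', r, rfl⟩ := head_cases i r
  · rw [act_of_head φ t h, act_of_head φ (s * t) h]
    exact act_mulHead hφ hU s t h
  · rw [act_cons_self, act_cons_self, mul_assoc]
    exact act_mulHead hφ hU s (t * t') hr.2.1

/-- The actions of all `S i` restrict to the same action of `U`. -/
theorem act_map (i : ι) (v : U) {r : Word U S} (hr : Reduced φ r) :
    act φ i (φ i v) r = baseMul φ v r := by
  obtain h | ⟨t, r, rfl⟩ := head_cases i r
  · rw [act_of_head φ _ h, mulHead_map φ (hφ i).injective]
  · rw [act_cons_self, mulHead_of_notMem]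
    · rfl
    · exact fun k => hr.1 (((hU i).mul_mem_iff_right ⟨v, rfl⟩).1 k)

omit hφ [PartialOrder U] in
theorem Reduced.baseMul {r : Word U S} (h : Reduced φ r) (v : U) : Reduced φ (baseMul φ v r) := by
  cases r with
  | nil u => trivial
  | cons i s r => exact ⟨fun k => h.1 (((hU i).mul_mem_iff_right ⟨v, rfl⟩).1 k), h.2⟩

theorem Reduced.mulHead {i : ι} (s : S i) {r : Word U S} (h : Reduced φ r)
    (hr : r.letters.head? ≠ some i) : Reduced φ (mulHead φ i s r) := by
  by_cases hs : s ∈ MonoidHom.mrange (φ i)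
  · obtain ⟨v, rfl⟩ := hs
    rw [mulHead_map φ (hφ i).injective]
    exact h.baseMul hU v
  · rw [mulHead_of_notMem φ hs]
    exact ⟨hs, hr, h⟩

theorem Reduced.act (i : ι) (s : S i) {r : Word U S} (h : Reduced φ r) :
    Reduced φ (act φ i s r) := by
  obtain h' | ⟨t, r, rfl⟩ := head_cases i r
  · rw [act_of_head φ s h']
    exact h.mulHead hφ hU s h'
  · rw [act_cons_self]
    exact h.2.2.mulHead hφ hU _ h.2.1

end Action

/-! ### Evaluation of words -/

section Eval

variable {M : Type*} [Monoid M]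

/-- The product of the images of the entries of a word in a monoid `M`. -/
def eval (β : U →* M) (θ : ∀ i, S i →* M) : Word U S → M
  | nil u => β u
  | cons i s r => θ i s * eval β θ r

variable {φ} {β : U →* M} {θ : ∀ i, S i →* M} {P : Set ι}

theorem eval_baseMul (hθ : ∀ i ∈ P, (θ i).comp (φ i) = β) (v : U) {r : Word U S}
    (hr : ∀ i ∈ r.letters, i ∈ P) : eval β θ (baseMul φ v r) = β v * eval β θ r := by
  cases r with
  | nil u => simp [baseMul, eval]
  | cons i s r =>
    have : θ i (φ i v) = β v := DFunLike.congr_fun (hθ i (hr i (by simp [letters]))) v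
    simp [baseMul, eval, this, mul_assoc]

/-- Evaluation is monotone on words whose indices belong to a set `P` of factors on which the
maps to `M` agree with the one of `U`. -/
theorem eval_mono [PartialOrder U] [∀ i, PartialOrder (S i)] [PartialOrder M] [MulLeftMono M]
    [MulRightMono M] (hβ : Monotone β) (hm : ∀ i, Monotone (θ i))
    (hθ : ∀ i ∈ P, (θ i).comp (φ i) = β) {r r' : Word U S} (h : Rel φ r r')
    (hr : ∀ i ∈ r.letters, i ∈ P) : eval β θ r ≤ eval β θ r' := by
  induction h with
  | nil h => exact hβ h
  | cons h _ ih => exact mul_le_mul' (hm _ h) (ih fun i hi => hr i (by simp [letters, hi]))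
  | slide i s v r =>
    have : θ i (φ i v) = β v := DFunLike.congr_fun (hθ i (hr i (by simp [letters]))) v
    rw [eval, eval, eval_baseMul hθ v (fun i hi => hr i (by simp [letters, hi])), map_mul, this,
      mul_assoc]
  | slide' i s v r =>
    have : θ i (φ i v) = β v := DFunLike.congr_fun (hθ i (hr i (by simp [letters]))) v
    rw [eval, eval, eval_baseMul hθ v (fun i hi => hr i (by simp [letters, hi])), map_mul, this,
      mul_assoc]
  | trans h _ ih ih' => exact (ih hr).trans (ih' (h.letters_eq ▸ hr))

theorem eval_mulHead (hθ : ∀ i ∈ P, (θ i).comp (φ i) = β) {i : ι} (hi : i ∈ P) (s : S i)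
    {r : Word U S} (hr : ∀ i ∈ r.letters, i ∈ P) :
    eval β θ (mulHead φ i s r) = θ i s * eval β θ r := by
  unfold mulHead
  split_ifs with h
  · rw [eval_baseMul hθ _ hr, ← DFunLike.congr_fun (hθ i hi) h.choose, MonoidHom.comp_apply,
      h.choose_spec]
  · rfl

theorem eval_act (hθ : ∀ i ∈ P, (θ i).comp (φ i) = β) {i : ι} (hi : i ∈ P) (s : S i)
    {r : Word U S} (hr : ∀ i ∈ r.letters, i ∈ P) :
    eval β θ (act φ i s r) = θ i s * eval β θ r := by
  obtain h | ⟨t, r, rfl⟩ := head_cases i r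
  · rw [act_of_head φ s h, eval_mulHead hθ hi s hr]
  · rw [act_cons_self, eval_mulHead hθ hi _ (fun i hi => hr i (by simp [letters, hi])), eval,
      map_mul, mul_assoc]

end Eval

theorem letters_act_nil_subset (i : ι) (s : S i) (u : U) :
    ∀ j ∈ (act φ i s (nil u)).letters, j ∈ ({i} : Set ι) := by
  rw [act_of_head φ s (by simp [letters])]
  unfold mulHead
  split_ifs <;> simp [letters]

theorem letters_act_nil_of_notMem {i : ι} {s : S i} (h : s ∉ MonoidHom.mrange (φ i)) (u : U) :
    (act φ i s (nil u)).letters = [i] := by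
  rw [act_of_head φ s (by simp [letters]), mulHead_of_notMem φ h]
  rfl

open Classical in
/-- One-letter words over `i` are ordered as in `S i`. -/
theorem le_of_act_nil_rel [PartialOrder U] [∀ i, PartialOrder (S i)] [∀ i, MulLeftMono (S i)]
    [∀ i, MulRightMono (S i)] {φ : ∀ i, U →* S i} (hφ : ∀ i, IsPoembedding (φ i)) {i : ι}
    {s t : S i} (h : Rel φ (act φ i s (nil 1)) (act φ i t (nil 1))) : s ≤ t := by
  -- The other factors are sent to `1`, which is harmless on words over `i`.
  let θ : ∀ j, S j →* S i := fun j => if h : j = i then h ▸ MonoidHom.id (S j) else 1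
  have hi : θ i = MonoidHom.id (S i) := dif_pos rfl
  have hm : ∀ j, Monotone (θ j) := by
    intro j
    by_cases hj : j = i
    · subst hj
      rw [hi]
      exact monotone_id
    · rw [show θ j = 1 from dif_neg hj]
      exact monotone_const
  have hθ : ∀ j ∈ ({i} : Set ι), (θ j).comp (φ j) = φ i := by
    rintro j rfl
    rw [hi]
    rfl
  have key := eval_mono (fun u v huv => (hφ i u v).2 huv) hm hθ h (letters_act_nil_subset φ i s 1)
  rw [eval_act hθ rfl s (by simp [letters]), eval_act hθ rfl t (by simp [letters]), hi] at key
  simpa [eval] using key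

end Word

/-! ### The poset of normal forms -/

section NormalForm

variable {U ι : Type*} {S : ι → Type*} [Monoid U] [∀ i, Monoid (S i)] (φ : ∀ i, U →* S i)

/-- The set of reduced words. -/
def ReducedWord : Type _ := {r : Word U S // r.Reduced φ}

variable [PartialOrder U] [∀ i, PartialOrder (S i)]

instance : Preorder (ReducedWord φ) where
  le r r' := Word.Rel φ r.1 r'.1
  le_refl r := Word.Rel.refl r.1
  le_trans _ _ _ := Word.Rel.trans

/-- Reduced words up to the equivalence belonging to `Word.Rel`: the disjoint union of the
alternating tensor products of the sets `S i \ U`. -/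
abbrev NormalForm : Type _ := Antisymmetrization (ReducedWord φ) (· ≤ ·)

namespace NormalForm

/-- The class of a reduced word. -/
def mk (r : Word U S) (hr : r.Reduced φ) : NormalForm φ :=
  toAntisymmetrization (α := ReducedWord φ) (· ≤ ·) ⟨r, hr⟩

/-- The class of the word without letters and with last entry `u`. -/
def ofBase (u : U) : NormalForm φ := mk φ (.nil u) (Word.reduced_nil φ u)

variable {φ}

theorem ind {motive : NormalForm φ → Prop} (h : ∀ r hr, motive (mk φ r hr)) (f : NormalForm φ) :
    motive f := Quotient.ind (fun r : ReducedWord φ => h r.1 r.2) f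

theorem mk_le_mk {r r' : Word U S} {hr : r.Reduced φ} {hr' : r'.Reduced φ} :
    mk φ r hr ≤ mk φ r' hr' ↔ Word.Rel φ r r' := Iff.rfl

theorem mk_eq_mk {r r' : Word U S} {hr : r.Reduced φ} {hr' : r'.Reduced φ} :
    mk φ r hr = mk φ r' hr' ↔ Word.Rel φ r r' ∧ Word.Rel φ r' r := le_antisymm_iff

theorem mk_congr {r r' : Word U S} {hr : r.Reduced φ} {hr' : r'.Reduced φ} (h : r = r') :
    mk φ r hr = mk φ r' hr' := by
  subst h
  rfl

/-- The indices of the letters of a normal form. -/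
def letters : NormalForm φ → List ι :=
  Quotient.lift (fun r : ReducedWord φ => r.1.letters) fun _ _ h => Word.Rel.letters_eq h.1

@[simp] theorem letters_mk (r : Word U S) (hr : r.Reduced φ) : (mk φ r hr).letters = r.letters :=
  rfl

theorem letters_eq_of_le {f g : NormalForm φ} (h : f ≤ g) : f.letters = g.letters := by
  induction f using ind with
  | h r hr =>
    induction g using ind with
    | h r' hr' => exact (mk_le_mk.1 h).letters_eq

theorem eq_ofBase_of_letters_eq_nil {f : NormalForm φ} (h : f.letters = []) :
    ∃ u, f = ofBase φ u := by
  induction f using ind with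
  | h r hr =>
    cases r with
    | nil u => exact ⟨u, rfl⟩
    | cons i s r => simp [Word.letters] at h

/-- Right multiplication of normal forms by an element of `U`. -/
def rightMul [MulRightMono U] (v : U) : NormalForm φ →o NormalForm φ :=
  OrderHom.antisymmetrization
    { toFun := fun r : ReducedWord φ => (⟨r.1.rightMul v, r.2.rightMul v⟩ : ReducedWord φ)
      monotone' := fun _ _ h => Word.Rel.rightMul h v }

theorem rightMul_mk [MulRightMono U] (v : U) (r : Word U S) (hr : r.Reduced φ) :
    rightMul v (mk φ r hr) = mk φ (r.rightMul v) (hr.rightMul v) := rfl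

theorem letters_rightMul [MulRightMono U] (v : U) (f : NormalForm φ) :
    (rightMul v f).letters = f.letters := by
  induction f using ind with
  | h r hr => rw [rightMul_mk, letters_mk, letters_mk, Word.letters_rightMul]

/-- Evaluation of normal forms in a monoid `M` that receives the whole amalgam. -/
def eval {M : Type*} [Monoid M] [PartialOrder M] [MulLeftMono M] [MulRightMono M] {β : U →* M}
    {θ : ∀ i, S i →* M} (hβ : Monotone β) (hm : ∀ i, Monotone (θ i))
    (hθ : ∀ i, (θ i).comp (φ i) = β) : NormalForm φ → M :=
  Quotient.lift (fun r : ReducedWord φ => r.1.eval β θ) fun _ _ h =>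
    le_antisymm
      (Word.eval_mono (P := Set.univ) hβ hm (fun i _ => hθ i) h.1 fun _ _ => trivial)
      (Word.eval_mono (P := Set.univ) hβ hm (fun i _ => hθ i) h.2 fun _ _ => trivial)

section Action

variable [MulLeftMono U] [MulRightMono U] [∀ i, MulLeftMono (S i)] [∀ i, MulRightMono (S i)]
  (hφ : ∀ i, IsPoembedding (φ i)) (hU : ∀ i, StronglyPounitary (MonoidHom.mrange (φ i)))

/-- The action of `S i` on normal forms by left multiplication. -/
noncomputable def act (i : ι) : S i →* (NormalForm φ →o NormalForm φ) where
  toFun s := OrderHom.antisymmetrization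
    { toFun := fun r : ReducedWord φ => (⟨r.1.act φ i s, r.2.act hφ hU i s⟩ : ReducedWord φ)
      monotone' := fun _ _ h => Word.act_mono hφ hU i le_rfl h }
  map_one' := OrderHom.ext _ _ <| funext <| ind fun r hr => by
    have h := Word.act_map hφ hU i 1 hr
    rw [map_one, Word.baseMul_one] at h
    exact mk_congr h
  map_mul' s t := OrderHom.ext _ _ <| funext <| ind fun r hr =>
    mk_eq_mk.2 (Word.act_act hφ hU s t hr).symm

theorem act_monotone (i : ι) : Monotone (act hφ hU i) := fun _ _ hs =>
  ind fun r _ => mk_le_mk.2 (Word.act_mono hφ hU i hs (.refl r))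

theorem act_map_mk (i : ι) (v : U) (r : Word U S) (hr : r.Reduced φ) :
    act hφ hU i (φ i v) (mk φ r hr) = mk φ (r.baseMul φ v) (hr.baseMul hU v) :=
  mk_congr (Word.act_map hφ hU i v hr)

theorem act_comp_eq (i j : ι) : (act hφ hU i).comp (φ i) = (act hφ hU j).comp (φ j) :=
  MonoidHom.ext fun v => OrderHom.ext _ _ <| funext <| ind fun r hr =>
    (act_map_mk hφ hU i v r hr).trans (act_map_mk hφ hU j v r hr).symm

theorem letters_act_map (i : ι) (v : U) (f : NormalForm φ) :
    (act hφ hU i (φ i v) f).letters = f.letters := by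
  induction f using ind with
  | h r hr => rw [act_map_mk, letters_mk, letters_mk, Word.letters_baseMul]

theorem act_map_ofBase_one (i : ι) (v : U) :
    act hφ hU i (φ i v) (ofBase φ 1) = rightMul v (ofBase φ 1) := by
  rw [ofBase, act_map_mk, rightMul_mk]
  exact mk_congr (congrArg Word.nil ((mul_one v).trans (one_mul v).symm))

theorem rightMul_act (v : U) (i : ι) (s : S i) (f : NormalForm φ) :
    rightMul v (act hφ hU i s f) = act hφ hU i s (rightMul v f) := by
  induction f using ind with
  | h r hr => exact mk_congr (Word.rightMul_act φ v i s r)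

theorem eval_act {M : Type*} [Monoid M] [PartialOrder M] [MulLeftMono M] [MulRightMono M]
    {β : U →* M} {θ : ∀ i, S i →* M} (hβ : Monotone β) (hm : ∀ i, Monotone (θ i))
    (hθ : ∀ i, (θ i).comp (φ i) = β) (i : ι) (s : S i) (f : NormalForm φ) :
    eval hβ hm hθ (act hφ hU i s f) = θ i s * eval hβ hm hθ f := by
  induction f using ind with
  | h r hr =>
    exact Word.eval_act (P := Set.univ) (fun i _ => hθ i) trivial s fun _ _ => trivial

end Action

end NormalForm

end NormalForm

/-! ### Pomonoids generated by the factors and acting on normal forms -/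

section Generated

variable {U ι : Type*} {S : ι → Type*} [Monoid U] [∀ i, Monoid (S i)] {φ : ∀ i, U →* S i}
  [PartialOrder U] [MulLeftMono U] [MulRightMono U]
  [∀ i, PartialOrder (S i)] [∀ i, MulLeftMono (S i)] [∀ i, MulRightMono (S i)]
  (hφ : ∀ i, IsPoembedding (φ i)) (hU : ∀ i, StronglyPounitary (MonoidHom.mrange (φ i)))
  {W : Type*} [Monoid W] {θ : ∀ i, S i →* W} {ψ : W →* (NormalForm φ →o NormalForm φ)}

/-- The factors embed: their elements are recovered, with the order, from their values at the empty
word. -/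
theorem isPoembedding_of_action [PartialOrder W] (hm : ∀ i, Monotone (θ i))
    (hψ : Monotone ψ)
    (hψθ : ∀ i, ψ.comp (θ i) = NormalForm.act hφ hU i) (i : ι) : IsPoembedding (θ i) := by
  refine fun s t => ⟨fun h => ?_, fun h => hm i h⟩
  have h' := hψ h (NormalForm.ofBase φ 1)
  rw [show ψ (θ i s) = _ from DFunLike.congr_fun (hψθ i) s,
    show ψ (θ i t) = _ from DFunLike.congr_fun (hψθ i) t] at h'
  exact Word.le_of_act_nil_rel hφ h'

/-- The images of different factors meet only in the image of `U`. -/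
theorem mem_mrange_of_action_eq (hψθ : ∀ i, ψ.comp (θ i) = NormalForm.act hφ hU i) {i j : ι}
    (hij : i ≠ j) {s : S i} {t : S j} (h : θ i s = θ j t) : s ∈ MonoidHom.mrange (φ i) := by
  by_contra hs
  have h' : NormalForm.act hφ hU i s (.ofBase φ 1) = NormalForm.act hφ hU j t (.ofBase φ 1) := by
    rw [← hψθ, ← hψθ, MonoidHom.comp_apply, MonoidHom.comp_apply, h]
  have hl : (Word.act φ i s (.nil 1)).letters = (Word.act φ j t (.nil 1)).letters :=
    congrArg NormalForm.letters h'
  rw [Word.letters_act_nil_of_notMem φ hs] at hl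
  exact hij (Word.letters_act_nil_subset φ j t 1 i (by rw [← hl]; simp))

variable [PartialOrder W] [MulLeftMono W] [MulRightMono W]

/-- The image of `U` is strongly pounitary: an element of `W` lies in it if and only if its value at
the empty word has no letters. -/
theorem stronglyPounitary_of_action (hm : ∀ i, Monotone (θ i)) (hψ : Monotone ψ)
    (hψθ : ∀ i, ψ.comp (θ i) = NormalForm.act hφ hU i) {β : U →* W}
    (hθ : ∀ i, (θ i).comp (φ i) = β) (i₀ : ι)
    (hgen : Submonoid.closure (⋃ i, Set.range (θ i)) = ⊤) :
    StronglyPounitary (MonoidHom.mrange β) := by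
  have hβ : Monotone β := by
    rw [← hθ i₀]
    exact fun u v h => hm i₀ ((hφ i₀ u v).2 h)
  have hψθ' : ∀ i s, ψ (θ i s) = NormalForm.act hφ hU i s := fun i s =>
    DFunLike.congr_fun (hψθ i) s
  have hβ₀ : ∀ v, ψ (β v) = NormalForm.act hφ hU i₀ (φ i₀ v) := by
    intro v
    rw [← hθ i₀, MonoidHom.comp_apply, hψθ']
  have hgen' : ∀ p : W, p ∈ Submonoid.closure (⋃ i, Set.range (θ i)) := by simp [hgen]
  have heval : ∀ (p : W) (f : NormalForm φ),
      NormalForm.eval hβ hm hθ (ψ p f) = p * NormalForm.eval hβ hm hθ f := by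
    intro p
    induction hgen' p using Submonoid.closure_induction with
    | mem p hp =>
      obtain ⟨i, s, rfl⟩ := Set.mem_iUnion.1 hp
      intro f
      rw [hψθ', NormalForm.eval_act]
    | one => simp
    | mul p q _ _ hp hq =>
      intro f
      rw [map_mul, mul_assoc, ← hq, ← hp]
      rfl
  -- Right multiplication by `U` keeps the letters, so those of `p (u 1)` agree with those of `p 1`.
  have hright : ∀ (v : U) (p : W) (f : NormalForm φ),
      NormalForm.rightMul v (ψ p f) = ψ p (NormalForm.rightMul v f) := by
    intro v p
    induction hgen' p using Submonoid.closure_induction with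
    | mem p hp =>
      obtain ⟨i, s, rfl⟩ := Set.mem_iUnion.1 hp
      intro f
      rw [hψθ', NormalForm.rightMul_act]
    | one => simp
    | mul p q _ _ hp hq =>
      intro f
      rw [map_mul]
      exact (hp _).trans (congrArg _ (hq _))
  have hmem : ∀ p : W, (ψ p (.ofBase φ 1)).letters = [] → p ∈ MonoidHom.mrange β := by
    intro p hp
    obtain ⟨u, hu⟩ := NormalForm.eq_ofBase_of_letters_eq_nil hp
    have h := heval p (.ofBase φ 1)
    rw [hu] at h
    refine ⟨u, h.trans ?_⟩
    change p * β 1 = p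
    rw [map_one, mul_one]
  have hletters : ∀ v : U, (ψ (β v) (.ofBase φ 1)).letters = [] := by
    intro v
    rw [hβ₀, NormalForm.letters_act_map]
    rfl
  have hcomp : ∀ {p q : W}, p ≤ q ∨ q ≤ p →
      (ψ p (.ofBase φ 1)).letters = (ψ q (.ofBase φ 1)).letters := by
    rintro p q (h | h)
    · exact NormalForm.letters_eq_of_le (hψ h _)
    · exact (NormalForm.letters_eq_of_le (hψ h _)).symm
  constructor
  · rintro _ ⟨u, rfl⟩ _ ⟨v, rfl⟩ p h
    refine hmem p ?_
    rw [← hletters v, hcomp h, map_mul]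
    change _ = (ψ p (ψ (β u) _)).letters
    rw [hβ₀, NormalForm.act_map_ofBase_one, ← hright, NormalForm.letters_rightMul]
  · rintro _ ⟨u, rfl⟩ _ ⟨v, rfl⟩ p h
    refine hmem p ?_
    rw [← hletters v, hcomp h, map_mul]
    change _ = (ψ (β u) (ψ p _)).letters
    rw [hβ₀, NormalForm.letters_act_map]

end Generated

/-! ### The amalgamated free product of two pomonoids -/

section Endomorphisms

variable {α : Type*} [PartialOrder α]

instance : MulLeftMono (α →o α) := ⟨fun f _ _ h a => f.monotone (h a)⟩

instance : MulRightMono (α →o α) := ⟨fun f _ _ h a => h (f a)⟩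

end Endomorphisms

section TwoFactors

variable (S₁ : Type v) (S₂ : Type w)

/-- Two monoids as a family indexed by `Bool`, lifted to a common universe. -/
def Factor : Bool → Type (max v w)
  | false => ULift.{w} S₁
  | true => ULift.{v} S₂

variable [Monoid S₁] [Monoid S₂]

instance : ∀ b, Monoid (Factor S₁ S₂ b)
  | false => inferInstanceAs (Monoid (ULift S₁))
  | true => inferInstanceAs (Monoid (ULift S₂))

instance [PartialOrder S₁] [PartialOrder S₂] : ∀ b, PartialOrder (Factor S₁ S₂ b)
  | false => inferInstanceAs (PartialOrder (ULift S₁))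
  | true => inferInstanceAs (PartialOrder (ULift S₂))

instance [PartialOrder S₁] [PartialOrder S₂] [MulLeftMono S₁] [MulLeftMono S₂] :
    ∀ b, MulLeftMono (Factor S₁ S₂ b)
  | false => ⟨fun s _ _ h => mul_le_mul_right (α := S₁) h s.down⟩
  | true => ⟨fun s _ _ h => mul_le_mul_right (α := S₂) h s.down⟩

instance [PartialOrder S₁] [PartialOrder S₂] [MulRightMono S₁] [MulRightMono S₂] :
    ∀ b, MulRightMono (Factor S₁ S₂ b)
  | false => ⟨fun s _ _ h => mul_le_mul_left (α := S₁) h s.down⟩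
  | true => ⟨fun s _ _ h => mul_le_mul_left (α := S₂) h s.down⟩

variable {S₁ S₂}

/-- Two homomorphisms from `U` as a family of homomorphisms to the factors. -/
def toFactor {U : Type*} [Monoid U] (φ₁ : U →* S₁) (φ₂ : U →* S₂) : ∀ b, U →* Factor S₁ S₂ b
  | false => (MulEquiv.ulift.symm : S₁ ≃* ULift S₁).toMonoidHom.comp φ₁
  | true => (MulEquiv.ulift.symm : S₂ ≃* ULift S₂).toMonoidHom.comp φ₂

/-- Two homomorphisms to `W` as a family of homomorphisms on the factors. -/
def ofFactor {W : Type*} [Monoid W] (θ₁ : S₁ →* W) (θ₂ : S₂ →* W) : ∀ b, Factor S₁ S₂ b →* W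
  | false => θ₁.comp (MulEquiv.ulift : ULift S₁ ≃* S₁).toMonoidHom
  | true => θ₂.comp (MulEquiv.ulift : ULift S₂ ≃* S₂).toMonoidHom

theorem stronglyPounitary_mrange_ulift {U S : Type*} [Monoid U] [Monoid S] [PartialOrder S]
    {φ : U →* S} (h : StronglyPounitary (MonoidHom.mrange φ)) :
    StronglyPounitary
      (MonoidHom.mrange ((MulEquiv.ulift.symm : S ≃* ULift S).toMonoidHom.comp φ)) := by
  constructor
  · rintro _ ⟨u, rfl⟩ _ ⟨v, rfl⟩ s hs
    obtain ⟨a, ha⟩ := h.1 _ ⟨u, rfl⟩ _ ⟨v, rfl⟩ s.down hs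
    exact ⟨a, ULift.down_injective ha⟩
  · rintro _ ⟨u, rfl⟩ _ ⟨v, rfl⟩ s hs
    obtain ⟨a, ha⟩ := h.2 _ ⟨u, rfl⟩ _ ⟨v, rfl⟩ s.down hs
    exact ⟨a, ULift.down_injective ha⟩

end TwoFactors

theorem AmalgProd.closure_range_union {U S₁ S₂ : Type*} [Monoid U] [Monoid S₁] [PartialOrder S₁]
    [Monoid S₂] [PartialOrder S₂] (φ₁ : U →* S₁) (φ₂ : U →* S₂) :
    Submonoid.closure (Set.range (AmalgProd.inl φ₁ φ₂) ∪ Set.range (AmalgProd.inr φ₁ φ₂)) = ⊤ := by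
  have h := congrArg (Submonoid.map (AmalgProd.mk φ₁ φ₂))
    (Monoid.Coprod.mclosure_range_inl_union_inr (M := S₁) (N := S₂))
  rw [MonoidHom.map_mclosure, Set.image_union, ← Set.range_comp, ← Set.range_comp,
    ← MonoidHom.mrange_eq_map, MonoidHom.mrange_eq_top.2 Quotient.mk_surjective] at h
  exact h

end Pomonoid

theorem theorem3
    {U : Type u} [Monoid U] [PartialOrder U] [MulLeftMono U] [MulRightMono U]
    {S₁ : Type v} [Monoid S₁] [PartialOrder S₁] [MulLeftMono S₁] [MulRightMono S₁]
    {S₂ : Type w} [Monoid S₂] [PartialOrder S₂] [MulLeftMono S₂] [MulRightMono S₂]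
    (φ₁ : U →* S₁) (φ₂ : U →* S₂)
    (hφ₁ : Pomonoid.IsPoembedding φ₁) (hφ₂ : Pomonoid.IsPoembedding φ₂)
    (h₁ : Pomonoid.StronglyPounitary (MonoidHom.mrange φ₁))
    (h₂ : Pomonoid.StronglyPounitary (MonoidHom.mrange φ₂)) :
    Pomonoid.StronglyPoembeddable.{max v w} φ₁ φ₂ ∧
    Pomonoid.IsStrongPoembedding φ₁ φ₂
      (Pomonoid.AmalgProd.inl φ₁ φ₂) (Pomonoid.AmalgProd.inr φ₁ φ₂) ∧
    Pomonoid.HasPoextension.{x, y} (MonoidHom.mrange (Pomonoid.AmalgProd.base φ₁ φ₂)) ∧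
    Pomonoid.StronglyPounitary (MonoidHom.mrange (Pomonoid.AmalgProd.base φ₁ φ₂)) := by
  open Pomonoid in
  let θ := ofFactor (AmalgProd.inl φ₁ φ₂) (AmalgProd.inr φ₁ φ₂)
  have hφ : ∀ b, IsPoembedding (toFactor φ₁ φ₂ b)
    | false => hφ₁
    | true => hφ₂
  have hU : ∀ b, StronglyPounitary (MonoidHom.mrange (toFactor φ₁ φ₂ b))
    | false => stronglyPounitary_mrange_ulift h₁
    | true => stronglyPounitary_mrange_ulift h₂
  have hm : ∀ b, Monotone (θ b)
    | false => fun _ _ h => AmalgProd.inl_mono φ₁ φ₂ h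
    | true => fun _ _ h => AmalgProd.inr_mono φ₁ φ₂ h
  have hθ : ∀ b, (θ b).comp (toFactor φ₁ φ₂ b) = AmalgProd.base φ₁ φ₂
    | false => rfl
    | true => (AmalgProd.inl_comp_eq φ₁ φ₂).symm
  obtain ⟨ψ, ⟨hψ, e₁, e₂⟩, -⟩ := AmalgProd.existsUnique_lift φ₁ φ₂
    ((NormalForm.act hφ hU false).comp (MulEquiv.ulift.symm : S₁ ≃* ULift.{w} S₁).toMonoidHom)
    ((NormalForm.act hφ hU true).comp (MulEquiv.ulift.symm : S₂ ≃* ULift.{v} S₂).toMonoidHom)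
    (fun _ _ h => NormalForm.act_monotone hφ hU false h)
    (fun _ _ h => NormalForm.act_monotone hφ hU true h)
    (NormalForm.act_comp_eq hφ hU false true)
  have hψθ : ∀ b, ψ.comp (θ b) = NormalForm.act hφ hU b
    | false => MonoidHom.ext fun s => DFunLike.congr_fun e₁ s.down
    | true => MonoidHom.ext fun s => DFunLike.congr_fun e₂ s.down
  have hgen : Submonoid.closure (⋃ b, Set.range (θ b)) = ⊤ := by
    rw [eq_top_iff, ← AmalgProd.closure_range_union φ₁ φ₂]
    refine Submonoid.closure_mono (Set.union_subset ?_ ?_)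
    · rintro _ ⟨s, rfl⟩
      exact Set.mem_iUnion.2 ⟨false, ULift.up s, rfl⟩
    · rintro _ ⟨s, rfl⟩
      exact Set.mem_iUnion.2 ⟨true, ULift.up s, rfl⟩
  have hemb : IsStrongPoembedding φ₁ φ₂ (AmalgProd.inl φ₁ φ₂) (AmalgProd.inr φ₁ φ₂) := by
    refine ⟨fun s t => isPoembedding_of_action hφ hU hm hψ hψθ false (ULift.up s) (ULift.up t),
      fun s t => isPoembedding_of_action hφ hU hm hψ hψθ true (ULift.up s) (ULift.up t),
      AmalgProd.inl_comp_eq φ₁ φ₂, Set.Subset.antisymm ?_ ?_⟩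
    · rintro _ ⟨⟨s, rfl⟩, ⟨t, ht⟩⟩
      obtain ⟨u, hu⟩ := mem_mrange_of_action_eq hφ hU hψθ (i := false) (j := true)
        Bool.false_ne_true (s := ULift.up s) (t := ULift.up t) ht.symm
      exact ⟨u, congrArg (fun s : ULift.{w} S₁ => AmalgProd.inl φ₁ φ₂ s.down) hu⟩
    · rintro _ ⟨u, rfl⟩
      exact ⟨⟨φ₁ u, rfl⟩, ⟨φ₂ u, (DFunLike.congr_fun (AmalgProd.inl_comp_eq φ₁ φ₂) u).symm⟩⟩
  have hpu := stronglyPounitary_of_action hφ hU hm hψ hψθ hθ false hgen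
  exact ⟨⟨AmalgProd φ₁ φ₂, _, _, inferInstance, inferInstance, _, _, hemb⟩, hemb,
    hpu.hasPoextension, hpu⟩
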